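/- Theorem (Dias da Silva--Fonseca). Let $K$ be a field of characteristic zero, $V$ a finite-dimensional $K$-vector space, $v_1,\dots,v_n \in V$, and $v^\otimes = v_1 \otimes \cdots \otimes v_n \in V^{\otimes n}$. Let the group algebra $K\mathfrak{S}_n$ act on $V^{\otimes n}$ from the right by permuting tensor positions, $(v_1 \otimes \cdots \otimes v_n)\sigma = v_{\sigma(1)} \otimes \cdots \otimes v_{\sigma(n)}$. Let $\lambda$ be a partition of $n$ and let $T$ be a tableau of shape $\lambda$, that is, a filling of the boxes of the Young diagram of $\lambda$ with the numbers $1,\dots,n$, each used once (no monotonicity is required). Put $$a_T = \sum_{\sigma \in \operatorname{Row}(T)} \sigma, \qquad b_T = \sum_{\sigma \in \operatorname{Col}(T)} \operatorname{sign}(\sigma)\,\sigma, \qquad c_T = b_T a_T,$$ where $\operatorname{Row}(T), \operatorname{Col}(T) \le \mathfrak{S}_n$ are the subgroups stabilizing each row, respectively each column, of $T$. Then the following are equivalent: (i) $v^\otimes c_T \neq 0$; (ii) $v^\otimes b_T \neq 0$; (iii) for every column of $T$, with set of entries $C$, the family $(v_i)_{i \in C}$ is linearly independent. -/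

import Mathlib

open scoped TensorProduct

/-- A tableau of shape `μ`: a filling of the boxes of the Young diagram `μ` with the `n` numbers
indexed by `Fin n`, each used exactly once (so `μ` is the diagram of a partition of `n`). -/
abbrev Tableau (μ : YoungDiagram) (n : ℕ) : Type :=
  {c : ℕ × ℕ // c ∈ μ.cells} ≃ Fin n

namespace Tableau

variable {μ : YoungDiagram} {n : ℕ}

/-- The index of the row of `T` that contains the number `k`. -/
def rowOf (T : Tableau μ n) (k : Fin n) : ℕ := (T.symm k).1.1

/-- The index of the column of `T` that contains the number `k`. -/
def colOf (T : Tableau μ n) (k : Fin n) : ℕ := (T.symm k).1.2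

/-- The set of numbers in column `j` of `T`. -/
def column (T : Tableau μ n) (j : ℕ) : Set (Fin n) := {k | T.colOf k = j}

/-- The permutations that move every number only inside a block on which `f` is constant. -/
def fiberGroup (f : Fin n → ℕ) : Subgroup (Equiv.Perm (Fin n)) where
  carrier := {σ | ∀ k, f (σ k) = f k}
  one_mem' := fun _ => rfl
  mul_mem' := fun {σ τ} hσ hτ k => (hσ (τ k)).trans (hτ k)
  inv_mem' := fun {σ} hσ k => by simpa using (hσ (σ⁻¹ k)).symm

/-- The row group of `T`: the permutations that stabilize each row of `T`. -/
def rowGroup (T : Tableau μ n) : Subgroup (Equiv.Perm (Fin n)) := fiberGroup T.rowOf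

/-- The column group of `T`: the permutations that stabilize each column of `T`. -/
def colGroup (T : Tableau μ n) : Subgroup (Equiv.Perm (Fin n)) := fiberGroup T.colOf

variable (K : Type*) [Field K]

open scoped Classical in
/-- The row symmetrizer `a_T`, in the group algebra of the symmetric group. -/
noncomputable def rowSymmetrizer (T : Tableau μ n) : MonoidAlgebra K (Equiv.Perm (Fin n)) :=
  ∑ σ : Equiv.Perm (Fin n) with σ ∈ T.rowGroup, MonoidAlgebra.single σ (1 : K)

open scoped Classical in
/-- The column antisymmetrizer `b_T`, in the group algebra of the symmetric group. -/
noncomputable def colAntisymmetrizer (T : Tableau μ n) : MonoidAlgebra K (Equiv.Perm (Fin n)) :=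
  ∑ σ : Equiv.Perm (Fin n) with σ ∈ T.colGroup,
    MonoidAlgebra.single σ ((Equiv.Perm.sign σ : ℤ) : K)

/-- The Young symmetrizer `c_T = b_T a_T`. -/
noncomputable def youngSymmetrizer (T : Tableau μ n) : MonoidAlgebra K (Equiv.Perm (Fin n)) :=
  T.colAntisymmetrizer K * T.rowSymmetrizer K

end Tableau

namespace TensorPower

variable (K : Type*) [Field K] (V : Type*) [AddCommGroup V] [Module K V] (n : ℕ)

/-- The right action of the symmetric group on `V^{⊗n}` by permuting tensor positions,
`(v₁ ⊗ ⋯ ⊗ vₙ) σ = v_{σ(1)} ⊗ ⋯ ⊗ v_{σ(n)}`, as a homomorphism to the opposite of the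
monoid of linear endomorphisms (see `permHom_tprod`). -/
noncomputable def permHom :
    Equiv.Perm (Fin n) →* (Module.End K (⨂[K] _ : Fin n, V))ᵐᵒᵖ where
  toFun σ := MulOpposite.op (PiTensorProduct.reindex K (fun _ : Fin n => V) σ.symm).toLinearMap
  map_one' := by
    apply MulOpposite.unop_injective
    ext v
    simp
    rfl
  map_mul' σ τ := by
    apply MulOpposite.unop_injective
    ext v
    simp
    rfl

variable {K V n}

theorem permHom_tprod (σ : Equiv.Perm (Fin n)) (v : Fin n → V) :
    (permHom K V n σ).unop (PiTensorProduct.tprod K v) =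
      PiTensorProduct.tprod K fun i => v (σ i) := by
  simp [permHom]

/-- The right action of the group algebra of the symmetric group on `V^{⊗n}`, extending
`permHom` linearly; `actRight t x` is `t x`. -/
noncomputable def actRight (t : ⨂[K] _ : Fin n, V)
    (x : MonoidAlgebra K (Equiv.Perm (Fin n))) : ⨂[K] _ : Fin n, V :=
  (MonoidAlgebra.lift K _ (Equiv.Perm (Fin n)) (permHom K V n) x).unop t

theorem actRight_single (v : Fin n → V) (σ : Equiv.Perm (Fin n)) (a : K) :
    actRight (PiTensorProduct.tprod K v) (MonoidAlgebra.single σ a) =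
      a • PiTensorProduct.tprod K fun i => v (σ i) := by
  simp [actRight, permHom_tprod]

theorem actRight_mul (t : ⨂[K] _ : Fin n, V) (x y : MonoidAlgebra K (Equiv.Perm (Fin n))) :
    actRight t (x * y) = actRight (actRight t x) y := by
  simp [actRight]

end TensorPower

namespace TensorPower

variable {K : Type*} [Field K] {V : Type*} [AddCommGroup V] [Module K V] {n : ℕ}

/-! (i) ⇒ (ii) because `c_T = b_T a_T`. For (ii) ⇒ (iii), `v ↦ v^⊗ b_T` is multilinear and vanishes
when two entries of one column carry equal vectors, so a dependent column kills it. For (iii) ⇒ (i),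
pair with a product of functionals that depend only on the row. Then `a_T` contributes just the
factor `|Row(T)|`, nonzero in characteristic zero, and the pairing with `v^⊗ b_T` is a product of
determinants, one per column. Each is a polynomial in the functionals, nonzero by independence of
its column; over an infinite field some choice makes all of them nonzero at once. -/

theorem actRight_sum {ι : Type*} (t : ⨂[K] _ : Fin n, V) (s : Finset ι)
    (x : ι → MonoidAlgebra K (Equiv.Perm (Fin n))) :
    actRight t (∑ i ∈ s, x i) = ∑ i ∈ s, actRight t (x i) := by
  simp [actRight, map_sum, Finset.unop_sum, LinearMap.sum_apply]

theorem actRight_zero_left (x : MonoidAlgebra K (Equiv.Perm (Fin n))) :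
    actRight (0 : ⨂[K] _ : Fin n, V) x = 0 := by
  simp [actRight]

/-- The functional on `V^{⊗n}` with `v₁ ⊗ ⋯ ⊗ vₙ ↦ f₁(v₁) ⋯ fₙ(vₙ)`. -/
noncomputable def prodDual (f : Fin n → Module.Dual K V) :
    (⨂[K] _ : Fin n, V) →ₗ[K] K :=
  PiTensorProduct.lift ((MultilinearMap.mkPiAlgebra K (Fin n) K).compLinearMap f)

theorem prodDual_tprod (f : Fin n → Module.Dual K V) (v : Fin n → V) :
    prodDual f (PiTensorProduct.tprod K v) = ∏ k, f k (v k) := by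
  simp [prodDual]

theorem prodDual_actRight_single (f : Fin n → Module.Dual K V) {τ : Equiv.Perm (Fin n)}
    (hτ : ∀ k, f (τ k) = f k) (t : ⨂[K] _ : Fin n, V) :
    prodDual f (actRight t (MonoidAlgebra.single τ 1)) = prodDual f t := by
  have h : prodDual f ∘ₗ (permHom K V n τ).unop = prodDual f := by
    ext v
    simp only [LinearMap.compMultilinearMap_apply, LinearMap.comp_apply, permHom_tprod,
      prodDual_tprod]
    rw [← Equiv.prod_comp τ fun k => f k (v k)]
    simp [hτ]
  simpa [actRight] using LinearMap.congr_fun h t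

end TensorPower

namespace Tableau

open TensorPower

variable {K : Type*} [Field K] {V : Type*} [AddCommGroup V] [Module K V]
  {n : ℕ} {μ : YoungDiagram}

theorem mem_rowGroup (T : Tableau μ n) {σ : Equiv.Perm (Fin n)} :
    σ ∈ T.rowGroup ↔ ∀ k, T.rowOf (σ k) = T.rowOf k := Iff.rfl

theorem mem_colGroup (T : Tableau μ n) {σ : Equiv.Perm (Fin n)} :
    σ ∈ T.colGroup ↔ ∀ k, T.colOf (σ k) = T.colOf k := Iff.rfl

theorem eq_of_rowOf_eq_of_colOf_eq (T : Tableau μ n) {k l : Fin n}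
    (hr : T.rowOf k = T.rowOf l) (hc : T.colOf k = T.colOf l) : k = l :=
  T.symm.injective (Subtype.ext (Prod.ext hr hc))

open scoped Classical in
theorem actRight_colAntisymmetrizer (T : Tableau μ n) (v : Fin n → V) :
    actRight (PiTensorProduct.tprod K v) (T.colAntisymmetrizer K) =
      ∑ σ : Equiv.Perm (Fin n) with σ ∈ T.colGroup,
        ((Equiv.Perm.sign σ : ℤ) : K) • PiTensorProduct.tprod K fun i => v (σ i) := by
  simp only [colAntisymmetrizer, actRight_sum, actRight_single]

/-- Left multiplication by the transposition of `k` and `l` pairs off terms with the same tensor and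
opposite signs. -/
theorem actRight_colAntisymmetrizer_eq_zero_of_eq (T : Tableau μ n) {v : Fin n → V}
    {k l : Fin n} (hkl : k ≠ l) (hc : T.colOf k = T.colOf l) (hv : v k = v l) :
    actRight (PiTensorProduct.tprod K v) (T.colAntisymmetrizer K) = 0 := by
  classical
  have hcol (i : Fin n) : T.colOf (Equiv.swap k l i) = T.colOf i := by
    rw [Equiv.swap_apply_def]; split_ifs <;> simp_all
  have hvs (i : Fin n) : v (Equiv.swap k l i) = v i := by
    rw [Equiv.swap_apply_def]; split_ifs <;> simp_all
  rw [actRight_colAntisymmetrizer]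
  refine Finset.sum_involution (fun σ _ => Equiv.swap k l * σ) ?_ ?_ ?_ ?_
  · intro σ _
    simp [Equiv.Perm.sign_swap hkl, hvs]
  · intro σ _ _ h
    exact hkl (Equiv.swap_eq_one_iff.mp (mul_eq_right.mp h))
  · intro σ hσ
    simp only [Finset.mem_filter, Finset.mem_univ, true_and, mem_colGroup] at hσ ⊢
    intro i
    rw [Equiv.Perm.mul_apply, hcol, hσ]
  · intro σ _
    simp [← _root_.mul_assoc]

theorem linearIndependent_column_of_actRight_ne_zero (T : Tableau μ n) {v : Fin n → V}
    (h : actRight (PiTensorProduct.tprod K v) (T.colAntisymmetrizer K) ≠ 0) (j : ℕ) :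
    LinearIndependent K (fun k : T.column j => v k) := by
  classical
  by_contra hdep
  apply h
  rw [linearIndependent_iff_notMem_span] at hdep
  push Not at hdep
  obtain ⟨k, hk⟩ := hdep
  let F : MultilinearMap K (fun _ : Fin n => V) (⨂[K] _ : Fin n, V) :=
    ((MonoidAlgebra.lift K _ _ (permHom K V n) (T.colAntisymmetrizer K)).unop).compMultilinearMap
      (PiTensorProduct.tprod K)
  -- With the other slots fixed, the map is linear in slot `k` and kills every other vector of the
  -- column, hence also `v k`.
  have hle : Submodule.span K ((fun k : T.column j => v k) '' (Set.univ \ {k})) ≤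
      LinearMap.ker (F.toLinearMap v k) := by
    rw [Submodule.span_le]
    rintro _ ⟨l, hl, rfl⟩
    have hlk : (l : Fin n) ≠ k := fun e => hl.2 (Subtype.ext e)
    change actRight (PiTensorProduct.tprod K (Function.update v k (v l)))
      (T.colAntisymmetrizer K) = 0
    exact T.actRight_colAntisymmetrizer_eq_zero_of_eq hlk (l.2.trans k.2.symm)
      (by simp [hlk])
  have hF : F (Function.update v k (v k)) = 0 := hle hk
  rwa [Function.update_eq_self] at hF

/-- The matrix with entries `x (row k) (v l)` for `k`, `l` in the same column, and zero elsewhere.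
Its determinant is the pairing of `v^⊗ b_T` with the product of the functionals `x (row k)`. -/
noncomputable def columnMatrix {R : Type*} [Zero R] (T : Tableau μ n)
    (A : ℕ → Fin n → R) : Matrix (Fin n) (Fin n) R :=
  Matrix.of fun k l => if T.colOf k = T.colOf l then A (T.rowOf k) l else 0

theorem columnMatrix_blockTriangular {R : Type*} [Zero R] (T : Tableau μ n)
    (A : ℕ → Fin n → R) : (T.columnMatrix A).BlockTriangular T.colOf :=
  fun _ _ h => if_neg h.ne'

theorem prodDual_colAntisymmetrizer (T : Tableau μ n) (v : Fin n → V)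
    (g : ℕ → Module.Dual K V) :
    prodDual (fun k => g (T.rowOf k))
        (actRight (PiTensorProduct.tprod K v) (T.colAntisymmetrizer K)) =
      (T.columnMatrix fun r l => g r (v l)).det := by
  classical
  rw [actRight_colAntisymmetrizer, map_sum, ← Matrix.det_transpose, Matrix.det_apply',
    Finset.sum_filter]
  refine Finset.sum_congr rfl fun σ _ => ?_
  split_ifs with hσ
  · rw [map_smul, prodDual_tprod, smul_eq_mul]
    congr 1
    refine Finset.prod_congr rfl fun k _ => ?_
    simp [columnMatrix, T.mem_colGroup.mp hσ k]
  -- Outside the column group, the Leibniz term meets a zero entry of the matrix.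
  · rw [mem_colGroup] at hσ
    push Not at hσ
    obtain ⟨k, hk⟩ := hσ
    rw [Finset.prod_eq_zero (Finset.mem_univ k), mul_zero]
    simp [columnMatrix, hk.symm]

open scoped Classical in
theorem prodDual_youngSymmetrizer (T : Tableau μ n) (v : Fin n → V)
    (g : ℕ → Module.Dual K V) :
    prodDual (fun k => g (T.rowOf k))
        (actRight (PiTensorProduct.tprod K v) (T.youngSymmetrizer K)) =
      Fintype.card T.rowGroup * (T.columnMatrix fun r l => g r (v l)).det := by
  rw [youngSymmetrizer, actRight_mul, rowSymmetrizer, actRight_sum, map_sum,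
    ← prodDual_colAntisymmetrizer]
  rw [Finset.sum_congr rfl fun τ hτ => prodDual_actRight_single _ (fun k => by
    rw [T.mem_rowGroup.mp (Finset.mem_filter.mp hτ).2 k]) _]
  rw [Finset.sum_const, nsmul_eq_mul, Fintype.card_subtype]

/-- Functionals dual to a linearly independent column, indexed by the rows. -/
theorem exists_dual_toSquareBlock_eq_one (T : Tableau μ n) {v : Fin n → V} {j : ℕ}
    (hv : LinearIndependent K (fun k : T.column j => v k)) :
    ∃ g : ℕ → Module.Dual K V,
      (T.columnMatrix fun r l => g r (v l)).toSquareBlock T.colOf j = 1 := by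
  classical
  have hdual (k : T.column j) : ∃ φ : Module.Dual K V,
      ∀ l : T.column j, φ (v l) = if k = l then 1 else 0 := by
    obtain ⟨φ, hφ⟩ := ((Module.Basis.span hv).coord k).exists_extend
    refine ⟨φ, fun l => ?_⟩
    have h := LinearMap.congr_fun hφ (Module.Basis.span hv l)
    rw [LinearMap.comp_apply, Submodule.subtype_apply, Module.Basis.span_apply] at h
    simp [h, Finsupp.single_apply, eq_comm]
  choose φ hφ using hdual
  -- A column meets each row at most once, so its dual functionals can be indexed by rows; rows
  -- missing the column get 0.
  refine ⟨fun r => if h : ∃ k : T.column j, T.rowOf k = r then φ h.choose else 0, ?_⟩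
  ext k l
  have hex : ∃ k' : T.column j, T.rowOf k' = T.rowOf k := ⟨k, rfl⟩
  have hk : hex.choose = k := Subtype.ext
    (T.eq_of_rowOf_eq_of_colOf_eq hex.choose_spec (hex.choose.2.trans k.2.symm))
  have hφkl : φ hex.choose (v l) = if k = l then 1 else 0 := by rw [hk]; exact hφ k l
  simp only [Matrix.toSquareBlock_def, columnMatrix, Matrix.of_apply, k.2, l.2, if_true,
    Matrix.one_apply, dif_pos hex]
  exact hφkl

theorem exists_dual_det_columnMatrix_ne_zero [Infinite K] [FiniteDimensional K V]
    (T : Tableau μ n) {v : Fin n → V}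
    (hv : ∀ j : ℕ, LinearIndependent K (fun k : T.column j => v k)) :
    ∃ g : ℕ → Module.Dual K V, (T.columnMatrix fun r l => g r (v l)).det ≠ 0 := by
  classical
  let b := Module.finBasis K (Module.Dual K V)
  -- Generic functionals: the coordinates in the basis `b` are indeterminates, one set for each row.
  let P : ℕ → Fin n → MvPolynomial (ℕ × Fin (Module.finrank K (Module.Dual K V))) K :=
    fun r l => ∑ a, MvPolynomial.X (r, a) * MvPolynomial.C (b a (v l))
  have hP (g : ℕ → Module.Dual K V) :
      (MvPolynomial.eval fun p => b.repr (g p.1) p.2).mapMatrix (T.columnMatrix P) =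
        T.columnMatrix fun r l => g r (v l) := by
    ext k l
    have h := LinearMap.congr_fun (b.sum_repr (g (T.rowOf k))) (v l)
    simp only [LinearMap.sum_apply, LinearMap.smul_apply, smul_eq_mul] at h
    simp only [columnMatrix, RingHom.mapMatrix_apply, Matrix.map_apply, Matrix.of_apply]
    split_ifs
    · simpa [P] using h
    · simp
  have hdet : (T.columnMatrix P).det ≠ 0 := by
    rw [(T.columnMatrix_blockTriangular P).det, Finset.prod_ne_zero_iff]
    -- Polynomials form a domain, so each column block may be specialized at its own `g`.
    intro j _ h0
    obtain ⟨g, hg⟩ := T.exists_dual_toSquareBlock_eq_one (hv j)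
    have h1 := congrArg (MvPolynomial.eval fun p => b.repr (g p.1) p.2) h0
    rw [RingHom.map_det, map_zero] at h1
    have h2 : (MvPolynomial.eval fun p => b.repr (g p.1) p.2).mapMatrix
        ((T.columnMatrix P).toSquareBlock T.colOf j) = 1 := by
      rw [← hg, ← hP g]; rfl
    rw [h2, Matrix.det_one] at h1
    exact one_ne_zero h1
  by_contra! hall
  apply hdet
  refine MvPolynomial.funext fun x => ?_
  have h := hall fun r => ∑ a, x (r, a) • b a
  have hx : (fun p : ℕ × _ => b.repr (∑ a, x (p.1, a) • b a) p.2) = x := by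
    funext p
    rw [b.repr_sum_self]
  rw [← hP, ← RingHom.map_det, hx] at h
  rw [h, map_zero]

theorem actRight_youngSymmetrizer_ne_zero [CharZero K] [FiniteDimensional K V]
    (T : Tableau μ n) {v : Fin n → V}
    (hv : ∀ j : ℕ, LinearIndependent K (fun k : T.column j => v k)) :
    actRight (PiTensorProduct.tprod K v) (T.youngSymmetrizer K) ≠ 0 := by
  classical
  intro h0
  have : Infinite K := CharZero.infinite K
  obtain ⟨g, hg⟩ := T.exists_dual_det_columnMatrix_ne_zero hv
  have h := T.prodDual_youngSymmetrizer v g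
  rw [h0, map_zero] at h
  exact mul_ne_zero (Nat.cast_ne_zero.mpr Fintype.card_ne_zero) hg h.symm

end Tableau

theorem mainTheorem2 {K : Type*} [Field K] [CharZero K]
    {V : Type*} [AddCommGroup V] [Module K V] [FiniteDimensional K V]
    {n : ℕ} {μ : YoungDiagram} (T : Tableau μ n) (v : Fin n → V) :
    (TensorPower.actRight (PiTensorProduct.tprod K v) (T.youngSymmetrizer K) ≠ 0 ↔
      TensorPower.actRight (PiTensorProduct.tprod K v) (T.colAntisymmetrizer K) ≠ 0) ∧
    (TensorPower.actRight (PiTensorProduct.tprod K v) (T.colAntisymmetrizer K) ≠ 0 ↔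
      ∀ j : ℕ, LinearIndependent K (fun k : T.column j => v k)) := by
  have h12 : TensorPower.actRight (PiTensorProduct.tprod K v) (T.youngSymmetrizer K) ≠ 0 →
      TensorPower.actRight (PiTensorProduct.tprod K v) (T.colAntisymmetrizer K) ≠ 0 := by
    intro h h0
    apply h
    rw [Tableau.youngSymmetrizer, TensorPower.actRight_mul, h0, TensorPower.actRight_zero_left]
  exact ⟨⟨h12, fun h => T.actRight_youngSymmetrizer_ne_zero
      (T.linearIndependent_column_of_actRight_ne_zero h)⟩,
    T.linearIndependent_column_of_actRight_ne_zero,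
    fun h => h12 (T.actRight_youngSymmetrizer_ne_zero h)⟩
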